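/- Let $G$ be a group that admits a finite presentation $\langle a_1,\dots,a_n \mid R_1,\dots,R_m\rangle$ of deficiency $n-m\ge d$, where $d\in\mathbb Z$ (that is, the deficiency of $G$, the maximum of $n-m$ over all finite presentations of $G$, is at least $d$). For a group $\Gamma$ and a prime $p$ let $b_1(\Gamma;\mathbb F_p)=\dim_{\mathbb F_p}H_1(\Gamma;\mathbb F_p)$, with trivial coefficients. For a finite group $H$ let $\Delta\subseteq\mathbb F_p[H]$ be the augmentation ideal, i.e. the kernel of the augmentation $\sum_h l_h h\mapsto\sum_h l_h$, let $\Delta^0=\mathbb F_p[H]$, and for $k\ge 0$ let $\lambda^k_p(H)=\dim_{\mathbb F_p}\Delta^k/\Delta^{k+1}$. Then for every prime $p$ the space $H_1(G;\mathbb F_p)$ is finite-dimensional and $b_1(G;\mathbb F_p)\ge d$. Moreover, for every normal subgroup $N$ of finite index in $G$ and every group $H$ with $G/N\cong H$, the space $H_1(N;\mathbb F_p)$ is finite-dimensional and, for every integer $k\ge 0$, $$b_1(N;\mathbb F_p)\;\ge\;1+b_1(G;\mathbb F_p)\,\lambda^k_p(H)+d\sum_{j=0}^{k-1}\lambda^j_p(H)-|H|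 .$$ -/

import Mathlib

universe u

noncomputable section

namespace HomologyEstimate

/-- A finite presentation `⟨a₁, …, aₙ ∣ R₁, …, Rₘ⟩` of the group `G`. The relators form a finite list
(repetitions and trivial relators are allowed). -/
structure FinitePresentation (G : Type u) [Group G] where
  /-- the number of generators -/
  n : ℕ
  /-- the number of relators -/
  m : ℕ
  /-- the relators, as words in the generators -/
  rel : Fin m → FreeGroup (Fin n)
  /-- the identification of the presented group with `G` -/
  iso : PresentedGroup (Set.range rel) ≃* G

/-- The deficiency of a finite presentation: number of generators minus number of relators. -/
def FinitePresentation.deficiency {G : Type u} [Group G] (P : FinitePresentation G) : ℤ :=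
  (P.n : ℤ) - (P.m : ℤ)

/-- The field with `p` elements, placed in the universe `u`
(Mathlib's group homology wants the group and the coefficient ring in the same universe). -/
abbrev Fp (p : ℕ) : Type u := ULift.{u} (ZMod p)

/-- `H₁(G; 𝔽_p)`: first homology of the group `G` with coefficients in the trivial module `𝔽_p`. -/
abbrev H₁ (p : ℕ) (G : Type u) [Group G] : Type u :=
  groupHomology (Rep.trivial (Fp.{u} p) G (Fp.{u} p)) 1

/-- `b₁(G; 𝔽_p) = dim H₁(G; 𝔽_p)`. -/
def b₁ (p : ℕ) (G : Type u) [Group G] : ℕ := Module.finrank (Fp.{u} p) (H₁ p G)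

/-- The augmentation `𝔽_p[H] → 𝔽_p`, the algebra map sending every element of `H` to `1`. -/
def augmentation (p : ℕ) (H : Type*) [Group H] : MonoidAlgebra (ZMod p) H →ₐ[ZMod p] ZMod p :=
  MonoidAlgebra.lift (ZMod p) (ZMod p) H 1

/-- The augmentation ideal `Δ` of `𝔽_p[H]`, the kernel of the augmentation. -/
def augmentationIdeal (p : ℕ) (H : Type*) [Group H] : Ideal (MonoidAlgebra (ZMod p) H) :=
  RingHom.ker (augmentation p H)

/-- The power `Δ ^ k` of the augmentation ideal, as an `𝔽_p`-subspace of `𝔽_p[H]`;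
`Δ ^ 0` is all of `𝔽_p[H]`. -/
def augmentationPow (p : ℕ) (H : Type*) [Group H] (k : ℕ) :
    Submodule (ZMod p) (MonoidAlgebra (ZMod p) H) :=
  (augmentationIdeal p H ^ k).restrictScalars (ZMod p)

/-- `λᵏ_p(H)`, the dimension over `𝔽_p` of `Δ ^ k / Δ ^ (k + 1)`. -/
def lam (p : ℕ) (H : Type*) [Group H] (k : ℕ) : ℕ :=
  Module.finrank (ZMod p)
    (augmentationPow p H k ⧸ (augmentationPow p H (k + 1)).submoduleOf (augmentationPow p H k))

end HomologyEstimate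

end

/-!
Write `k = 𝔽_p` and let `π : G → H` be the quotient map with kernel `N`. All first homology groups
are replaced by their duals `Hom(Γ, k)`, which have the same dimension (`finite_H₁`).

Let `A = k[H]*`, a `G`-module through `π`. By Shapiro's lemma `H¹(G; A) = H¹(N; k)`, so the space
`Z¹(G; A)` of crossed homomorphisms `G → A` has dimension `b₁(N) + |H| - 1`; only the inequality
`≤` is needed (`finrank_crossedHoms_coindRep_add_one_le`).

To bound `Z¹(G; A)` from below, filter `A` by the annihilators `Aⱼ` of the powers `Δʲ` (`annPow`).
The dimension of `Aⱼ` is `λ⁰ + ⋯ + λʲ⁻¹`, and `G` acts trivially on `Aⱼ₊₁ / Aⱼ`. A crossed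
homomorphism with values in `A` amounts to a choice of values `x ∈ Aⁿ` at the `n` generators of the
presentation for which the Fox derivatives of the `m` relators vanish. Take tuples
`x ∈ (Aₖ₊₁)ⁿ` which modulo `Aₖ` come from a homomorphism `G → Aₖ₊₁ / Aₖ`. These form a space of
dimension `b₁(G) λᵏ + n dim Aₖ`, and the Fox derivatives of the relators take values in `Aₖ`
on it, so they impose at most `m dim Aₖ` linear conditions. This gives
`dim Z¹(G; A) ≥ b₁(G) λᵏ + (n - m) dim Aₖ` (`FinitePresentation.finrank_crossedHoms_ge`), and the
two bounds together are the theorem. The bound `d ≤ b₁(G)` is the same estimate for the trivial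
module `k` (`FinitePresentation.deficiency_le`).
-/

open scoped TensorProduct

noncomputable section

namespace HomologyEstimate

/-! ### First homology and homomorphisms to the prime field -/

section Homology

variable {p : ℕ} [Fact p.Prime]

lemma exists_natCast_eq (c : Fp p) : ∃ n : ℕ, (n : Fp p) = c :=
  ⟨c.down.val, congrArg ULift.up (ZMod.natCast_zmod_val c.down)⟩

lemma map_Fp_smul {M M' : Type*} [AddCommGroup M] [AddCommGroup M'] [Module (Fp p) M]
    [Module (Fp p) M'] (f : M →+ M') (c : Fp p) (x : M) : f (c • x) = c • f x := by
  obtain ⟨n, rfl⟩ := exists_natCast_eq c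
  rw [Nat.cast_smul_eq_nsmul, Nat.cast_smul_eq_nsmul, map_nsmul]

variable {G : Type*} [Group G]

/-- The homomorphism `G → 𝔽_p`, `g ↦ ℓ [g ⊗ 1]`, attached to a linear form `ℓ` on `H₁(G; 𝔽_p)`,
where `H₁(G; 𝔽_p) ≃ Gᵃᵇ ⊗ 𝔽_p`. -/
def dualToHom (p : ℕ) [Fact p.Prime] (G : Type*) [Group G] :
    Module.Dual (Fp p) (H₁ p G) →+ (Additive G →+ ZMod p) where
  toFun l :=
    { toFun := fun g => (l ((groupHomology.H1AddEquivOfIsTrivial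
        (Rep.trivial (Fp p) G (Fp p))).symm
          (Additive.ofMul (Abelianization.of g.toMul) ⊗ₜ[ℤ] (1 : Fp p)))).down
      map_zero' := by simp
      map_add' := fun a b => by simp [TensorProduct.add_tmul] }
  map_zero' := by ext; rfl
  map_add' l l' := by ext; rfl

lemma dualToHom_bijective : Function.Bijective (dualToHom p G) := by
  set e := groupHomology.H1AddEquivOfIsTrivial (Rep.trivial (Fp p) G (Fp p)) with he
  constructor
  · rw [injective_iff_map_eq_zero]
    intro l hl
    have key : ∀ t, l (e.symm t) = 0 := by
      intro t
      induction t with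
      | zero => simp
      | add x y hx hy => rw [map_add, map_add, hx, hy, add_zero]
      | tmul a c =>
        obtain ⟨g, rfl⟩ : ∃ g : G, Additive.ofMul (Abelianization.of g) = a :=
          ⟨_, congrArg Additive.ofMul (Quotient.out_eq a.toMul)⟩
        change Fp p at c
        obtain ⟨n, rfl⟩ : ∃ n : ℕ, n • (1 : Fp p) = c := by
          simpa using exists_natCast_eq c
        have h1 : l (e.symm (Additive.ofMul (Abelianization.of g) ⊗ₜ[ℤ] (1 : Fp p))) = 0 :=
          ULift.ext _ _ (DFunLike.congr_fun hl (Additive.ofMul g))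
        have h2 : (Additive.ofMul (Abelianization.of g) ⊗ₜ[ℤ] (n • (1 : Fp p)))
            = n • (Additive.ofMul (Abelianization.of g) ⊗ₜ[ℤ] (1 : Fp p)) := by
          rw [TensorProduct.tmul_smul]
        refine (congrArg (fun t => l (e.symm t)) h2).trans ?_
        change l (e.symm (n • _)) = 0
        rw [map_nsmul, map_nsmul]
        exact (congrArg (n • ·) h1).trans (nsmul_zero n)
    refine LinearMap.ext fun x => ?_
    have := key (e x)
    rwa [e.symm_apply_apply] at this
  · intro φ
    let φ' : Additive (Abelianization G) →+ ZMod p :=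
      MonoidHom.toAdditiveLeft (Abelianization.lift (AddMonoidHom.toMultiplicativeRight φ))
    let φ'' : Additive (Abelianization G) →ₗ[ℤ] Fp p :=
      (AddEquiv.ulift.symm.toAddMonoidHom.comp φ').toIntLinearMap
    let f : (Additive (Abelianization G) ⊗[ℤ] Fp p) →ₗ[ℤ] Fp p :=
      TensorProduct.lift ((LinearMap.mul ℤ (Fp p)).comp φ'')
    let F : H₁ p G →+ Fp p := f.toAddMonoidHom.comp e.toAddMonoidHom
    refine ⟨{ toFun := F, map_add' := map_add F, map_smul' := map_Fp_smul F }, ?_⟩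
    ext g
    change (f (e (e.symm _))).down = _
    rw [e.apply_symm_apply]
    -- `TensorProduct.lift` computes definitionally on pure tensors
    change (φ'' (Additive.ofMul (Abelianization.of g)) * (1 : Fp p)).down = _
    rw [mul_one]
    rfl

/-- `H₁(G; 𝔽_p)` and `Hom(G, 𝔽_p)`, being dual to each other, have the same dimension. -/
lemma finite_H₁ [Module.Finite (ZMod p) (Additive G →+ ZMod p)] :
    Module.Finite (Fp p) (H₁ p G) ∧ b₁ p G = Module.finrank (ZMod p) (Additive G →+ ZMod p) := by
  let j : Module.Dual (Fp p) (H₁ p G) ≃+ (Additive G →+ ZMod p) :=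
    AddEquiv.ofBijective _ dualToHom_bijective
  have hr : Module.rank (Fp p) (Module.Dual (Fp p) (H₁ p G))
      = Module.rank (ZMod p) (Additive G →+ ZMod p) :=
    rank_eq_of_equiv_equiv (fun c : Fp p => c.down) j ULift.down_bijective fun c l => rfl
  have : Module.Free (Fp p) (Module.Dual (Fp p) (H₁ p G)) := Module.Free.of_divisionRing _ _
  have hfin : Module.Finite (Fp p) (Module.Dual (Fp p) (H₁ p G)) := by
    rw [← Module.rank_lt_aleph0_iff, hr, Module.rank_lt_aleph0_iff]
    infer_instance
  have : Module.Free (Fp p) (H₁ p G) := Module.Free.of_divisionRing _ _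
  refine ⟨(Module.finite_dual_iff (Fp p)).1 hfin, ?_⟩
  rw [b₁, ← Subspace.dual_finrank_eq, Module.finrank, Module.finrank, hr]

end Homology

/-! ### Crossed homomorphisms -/

section CrossedHom

variable {k G A : Type*} [Field k] [Group G] [AddCommGroup A] [Module k A]

/-- The crossed homomorphisms `D : G → A` for a representation `ρ` on `A`, that is, the space
`Z¹(G; A)` of `1`-cocycles. -/
def crossedHoms (ρ : Representation k G A) : Submodule k (G → A) where
  carrier := {D | ∀ g h, D (g * h) = D g + ρ g (D h)}
  zero_mem' := by simp
  add_mem' {D D'} hD hD' g h := by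
    simp only [Pi.add_apply, hD g h, hD' g h, map_add]
    abel
  smul_mem' c D hD g h := by simp [hD g h]

lemma crossedHoms.map_one {ρ : Representation k G A} {D : G → A} (hD : D ∈ crossedHoms ρ) :
    D 1 = 0 := by
  simpa using hD 1 1

lemma crossedHoms.finite [Group.FG G] [Module.Finite k A] (ρ : Representation k G A) :
    Module.Finite k (crossedHoms ρ) := by
  obtain ⟨S, hS, hfin⟩ := Group.fg_iff.1 ‹Group.FG G›
  have := hfin.to_subtype
  let ev : crossedHoms ρ →ₗ[k] (S → A) :=
    { toFun := fun D s => D.1 s, map_add' := fun _ _ => rfl, map_smul' := fun _ _ => rfl }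
  refine Module.Finite.of_injective ev ?_
  rw [injective_iff_map_eq_zero]
  rintro ⟨D, hD⟩ h
  have key : ∀ g, D g = 0 := by
    intro g
    have hg : g ∈ Subgroup.closure S := hS ▸ Subgroup.mem_top g
    induction hg using Subgroup.closure_induction with
    | mem x hx => exact congrFun h ⟨x, hx⟩
    | one => exact crossedHoms.map_one hD
    | mul x y _ _ hx hy => rw [hD, hx, hy, map_zero, add_zero]
    | inv x _ hx =>
      have h1 := hD x⁻¹ x
      rw [inv_mul_cancel, crossedHoms.map_one hD, hx, map_zero, add_zero] at h1
      exact h1.symm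
  exact Subtype.ext (funext key)

/-- Homomorphisms `G → k`, viewed as crossed homomorphisms for the trivial action. -/
def crossedHomsTrivialEquiv (k G : Type*) [Field k] [Group G] :
    crossedHoms (Representation.trivial k G k) ≃ₗ[k] (Additive G →+ k) where
  toFun D :=
    { toFun := fun g => D.1 g.toMul
      map_zero' := crossedHoms.map_one D.2
      map_add' := fun a b => D.2 a.toMul b.toMul }
  invFun φ := ⟨fun g => φ (Additive.ofMul g), fun g h => by simp⟩
  left_inv _ := rfl
  right_inv _ := rfl
  map_add' _ _ := rfl
  map_smul' _ _ := rfl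

instance [Group.FG G] : Module.Finite k (Additive G →+ k) :=
  have := crossedHoms.finite (Representation.trivial k G k)
  Module.Finite.equiv (crossedHomsTrivialEquiv k G)

end CrossedHom

/-! ### Fox derivatives -/

section Fox

variable {k G A ι : Type*} [Field k] [Group G] [AddCommGroup A] [Module k A]

/-- The automorphism `(a, x) ↦ (g a + xᵢ, x)` of `A × A^ι`, an affine transformation of `A` with
generic translation part. -/
def foxGen (ρ : Representation k G A) (g : G) (i : ι) : (A × (ι → A)) ≃ₗ[k] (A × (ι → A)) where
  toFun v := (ρ g v.1 + v.2 i, v.2)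
  invFun v := (ρ g⁻¹ (v.1 - v.2 i), v.2)
  map_add' v w := by
    refine Prod.ext ?_ rfl
    simp only [Prod.fst_add, Prod.snd_add, Pi.add_apply, map_add]
    abel
  map_smul' c v := by simp
  left_inv v := by simp
  right_inv v := by simp

/-- The action of the free group on `A × A^ι` through the automorphisms `foxGen`. -/
def foxHom (ρ : Representation k G A) (γ : ι → G) :
    FreeGroup ι →* ((A × (ι → A)) ≃ₗ[k] (A × (ι → A))) :=
  FreeGroup.lift fun i => foxGen ρ (γ i) i

/-- The Fox derivative: `fox ρ γ w x` is the value at the word `w` of the crossed homomorphism on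
the free group that takes the value `xᵢ` at the `i`-th generator, the free group acting on `A`
through `γ`. -/
def fox (ρ : Representation k G A) (γ : ι → G) (w : FreeGroup ι) : (ι → A) →ₗ[k] A :=
  LinearMap.fst k A (ι → A) ∘ₗ (foxHom ρ γ w).toLinearMap ∘ₗ LinearMap.inr k A (ι → A)

variable (ρ : Representation k G A) (γ : ι → G)

lemma foxHom_apply (w : FreeGroup ι) (a : A) (x : ι → A) :
    foxHom ρ γ w (a, x) = (ρ (FreeGroup.lift γ w) a + fox ρ γ w x, x) := by
  induction w using FreeGroup.induction_on generalizing a with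
  | C1 => simp [fox]
  | of i => simp [fox, foxHom, foxGen]
  | inv_of i _ =>
    simp only [fox, foxHom, map_inv, FreeGroup.lift_apply_of, LinearMap.coe_comp,
      Function.comp_apply, LinearMap.inr_apply, LinearMap.fst_apply, LinearEquiv.coe_coe]
    change (ρ (γ i)⁻¹ (a - x i), x) = (ρ (γ i)⁻¹ a + ρ (γ i)⁻¹ (0 - x i), x)
    rw [← map_add]
    congr 2
    abel
  | mul u v hu hv =>
    have h : ∀ b, foxHom ρ γ (u * v) (b, x) = (ρ (FreeGroup.lift γ u)
        (ρ (FreeGroup.lift γ v) b + fox ρ γ v x) + fox ρ γ u x, x) := fun b => by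
      rw [map_mul, LinearEquiv.mul_apply, hv, hu]
    have h' : fox ρ γ (u * v) x = (foxHom ρ γ (u * v) (0, x)).1 := rfl
    rw [h, h', h]
    simp [add_assoc]

lemma fox_one (x : ι → A) : fox ρ γ 1 x = 0 := by simp [fox]

lemma fox_of (i : ι) (x : ι → A) : fox ρ γ (FreeGroup.of i) x = x i := by
  simp [fox, foxHom, foxGen]

lemma fox_mul (u v : FreeGroup ι) (x : ι → A) :
    fox ρ γ (u * v) x = fox ρ γ u x + ρ (FreeGroup.lift γ u) (fox ρ γ v x) := by
  have h' : fox ρ γ (u * v) x = (foxHom ρ γ (u * v) (0, x)).1 := rfl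
  rw [h', map_mul, LinearEquiv.mul_apply, foxHom_apply, foxHom_apply]
  simp [add_comm]

lemma fox_inv (u : FreeGroup ι) (x : ι → A) :
    fox ρ γ u⁻¹ x = -ρ (FreeGroup.lift γ u)⁻¹ (fox ρ γ u x) := by
  have h := fox_mul ρ γ u⁻¹ u x
  rw [inv_mul_cancel, fox_one, map_inv] at h
  exact eq_neg_of_add_eq_zero_left h.symm

variable {ρ γ} in
/-- If the Fox derivatives vanish on a set `R` of relators, they vanish on all consequences of
`R`. -/
lemma fox_eq_zero_of_mem_normalClosure {R : Set (FreeGroup ι)} {x : ι → A}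
    (h1 : ∀ r ∈ R, FreeGroup.lift γ r = 1) (h2 : ∀ r ∈ R, fox ρ γ r x = 0)
    {w : FreeGroup ι} (hw : w ∈ Subgroup.normalClosure R) :
    FreeGroup.lift γ w = 1 ∧ fox ρ γ w x = 0 := by
  let K : Subgroup (FreeGroup ι) :=
    { carrier := {w | FreeGroup.lift γ w = 1 ∧ fox ρ γ w x = 0}
      one_mem' := ⟨map_one _, fox_one ρ γ x⟩
      mul_mem' := fun {a b} ha hb =>
        ⟨by rw [map_mul, ha.1, hb.1, one_mul], by rw [fox_mul, ha.2, hb.2, map_zero, add_zero]⟩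
      inv_mem' := fun {a} ha =>
        ⟨by rw [map_inv, ha.1, inv_one], by rw [fox_inv, ha.2, map_zero, neg_zero]⟩ }
  have hK : K.Normal := ⟨fun w hw g => by
    refine ⟨by rw [map_mul, map_mul, hw.1, mul_one, map_inv, mul_inv_cancel], ?_⟩
    rw [fox_mul, fox_mul, hw.2, fox_inv, map_mul, hw.1]
    simp⟩
  exact Subgroup.normalClosure_le_normal (N := K) (fun r hr => ⟨h1 r hr, h2 r hr⟩) hw

variable {ρ γ} in
/-- If the group acts trivially on `C / B`, crossed homomorphisms to `C` become homomorphisms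
modulo `B`; so `xᵢ ≡ φ(γᵢ)` for all generators implies `fox w x ≡ φ(w)` for all words. -/
lemma fox_sub_mem {B C : Submodule k A} (hBC : B ≤ C) (hC : ∀ g, ∀ a ∈ C, ρ g a - a ∈ B)
    (φ : Additive G →+ A) (hφ : ∀ g, φ g ∈ C) {x : ι → A}
    (hx : ∀ i, x i - φ (Additive.ofMul (γ i)) ∈ B) (w : FreeGroup ι) :
    fox ρ γ w x - φ (Additive.ofMul (FreeGroup.lift γ w)) ∈ B := by
  have hmem : ∀ {a : A} {g : G}, a - φ g ∈ B → a ∈ C := fun {a g} h => by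
    simpa using C.add_mem (hBC h) (hφ g)
  induction w using FreeGroup.induction_on with
  | C1 => simp [fox_one]
  | of i => simpa [fox_of] using hx i
  | inv_of i h =>
    rw [fox_inv, map_inv (FreeGroup.lift γ), ofMul_inv, map_neg]
    have h1 := hC (FreeGroup.lift γ (FreeGroup.of i))⁻¹ _ (hmem h)
    have h2 := B.neg_mem (B.add_mem h1 h)
    convert h2 using 1
    abel
  | mul u v hu hv =>
    rw [fox_mul, map_mul, ofMul_mul, map_add]
    have h1 := hC (FreeGroup.lift γ u) _ (hmem hv)
    have h2 := B.add_mem (B.add_mem h1 hu) hv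
    convert h2 using 1
    abel

end Fox
/-! ### Crossed homomorphisms on a finitely presented group -/

section Presentation

variable {G : Type*} [Group G]

/-- The images in `G` of the generators of a presentation. -/
def FinitePresentation.gen (P : FinitePresentation G) (i : Fin P.n) : G :=
  P.iso (PresentedGroup.of i)

variable (P : FinitePresentation G)

lemma FinitePresentation.lift_gen (w : FreeGroup (Fin P.n)) :
    FreeGroup.lift P.gen w = P.iso (PresentedGroup.mk _ w) := by
  have : FreeGroup.lift P.gen = (P.iso.toMonoidHom.comp (PresentedGroup.mk (Set.range P.rel))) := by
    ext i
    simp [FinitePresentation.gen, PresentedGroup.of]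
  exact DFunLike.congr_fun this w

lemma FinitePresentation.lift_gen_surjective : Function.Surjective (FreeGroup.lift P.gen) := by
  intro g
  obtain ⟨w, hw⟩ := PresentedGroup.mk_surjective _ (P.iso.symm g)
  exact ⟨w, by rw [P.lift_gen, hw, MulEquiv.apply_symm_apply]⟩

lemma FinitePresentation.lift_gen_eq_one_iff (w : FreeGroup (Fin P.n)) :
    FreeGroup.lift P.gen w = 1 ↔ w ∈ Subgroup.normalClosure (Set.range P.rel) := by
  rw [P.lift_gen, MulEquiv.map_eq_one_iff]
  exact QuotientGroup.eq_one_iff w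

lemma FinitePresentation.lift_gen_rel (j : Fin P.m) : FreeGroup.lift P.gen (P.rel j) = 1 :=
  (P.lift_gen_eq_one_iff _).2 (Subgroup.subset_normalClosure ⟨j, rfl⟩)

lemma FinitePresentation.fg (P : FinitePresentation G) : Group.FG G :=
  Group.fg_of_surjective P.lift_gen_surjective

lemma FinitePresentation.hom_eq_zero {A : Type*} [AddCommGroup A] {φ : Additive G →+ A}
    (h : ∀ i, φ (Additive.ofMul (P.gen i)) = 0) : φ = 0 := by
  have h' : (AddMonoidHom.toMultiplicativeRight φ).comp (FreeGroup.lift P.gen) = 1 := by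
    ext i
    simpa using h i
  ext g
  obtain ⟨w, rfl⟩ := P.lift_gen_surjective g
  exact DFunLike.congr_fun h' w

variable {k A : Type*} [Field k] [AddCommGroup A] [Module k A] (ρ : Representation k G A)

/-- The crossed homomorphism on `G` with prescribed values at the generators. It is only meaningful
when the Fox derivatives of the relators vanish, see `crossedHomOfGen_apply`. -/
def FinitePresentation.crossedHomOfGen : (Fin P.n → A) →ₗ[k] (G → A) :=
  LinearMap.pi fun g => fox ρ P.gen (Function.surjInv P.lift_gen_surjective g)

variable {ρ P} {x : Fin P.n → A}

lemma FinitePresentation.crossedHomOfGen_apply (hx : ∀ j, fox ρ P.gen (P.rel j) x = 0)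
    (w : FreeGroup (Fin P.n)) :
    P.crossedHomOfGen ρ x (FreeGroup.lift P.gen w) = fox ρ P.gen w x := by
  set u := Function.surjInv P.lift_gen_surjective (FreeGroup.lift P.gen w) with hu
  have huw : FreeGroup.lift P.gen u = FreeGroup.lift P.gen w :=
    Function.surjInv_eq P.lift_gen_surjective _
  have h1 : w⁻¹ * u ∈ Subgroup.normalClosure (Set.range P.rel) := by
    rw [← P.lift_gen_eq_one_iff, map_mul, map_inv, huw, inv_mul_cancel]
  have h2 := fox_eq_zero_of_mem_normalClosure (ρ := ρ) (γ := P.gen) (x := x)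
    (Set.forall_mem_range.2 P.lift_gen_rel) (Set.forall_mem_range.2 hx) h1
  have h3 := fox_mul ρ P.gen w (w⁻¹ * u) x
  rwa [mul_inv_cancel_left, h2.2, map_zero, add_zero] at h3

lemma FinitePresentation.crossedHomOfGen_mem (hx : ∀ j, fox ρ P.gen (P.rel j) x = 0) :
    P.crossedHomOfGen ρ x ∈ crossedHoms ρ := by
  intro g h
  obtain ⟨u, rfl⟩ := P.lift_gen_surjective g
  obtain ⟨v, rfl⟩ := P.lift_gen_surjective h
  rw [← map_mul, crossedHomOfGen_apply hx, crossedHomOfGen_apply hx, crossedHomOfGen_apply hx,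
    fox_mul]

variable (P) in
/-- The Euler characteristic estimate for crossed homomorphisms. Let `B ⊕ V ⊆ A`, the group acting
trivially on `B ⊕ V` modulo `B`. Consider tuples of values at the generators of the form
`φ(γᵢ) + bᵢ` with `φ : G → V` a homomorphism and `bᵢ ∈ B`: the Fox derivatives of the `m` relators
then lie in `B`, hence impose only `m · dim B` conditions. -/
theorem FinitePresentation.finrank_crossedHoms_ge [Module.Finite k A] {B V : Submodule k A}
    (hdisj : Disjoint B V) (hact : ∀ g, ∀ a ∈ B ⊔ V, ρ g a - a ∈ B) :
    Module.finrank k V * Module.finrank k (Additive G →+ k) + P.n * Module.finrank k B ≤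
      Module.finrank k (crossedHoms ρ) + P.m * Module.finrank k B := by
  have := P.fg
  have := crossedHoms.finite ρ
  let l := Module.finrank k V
  let e : (Fin l → k) ≃ₗ[k] V := (Module.finBasis k V).equivFun.symm
  -- a tuple of homomorphisms `G → k` stands for a homomorphism `G → V`
  let φ : (Fin l → Additive G →+ k) →ₗ[k] (Additive G →+ V) :=
    { toFun := fun ψ => e.toLinearMap.toAddMonoidHom.comp
        { toFun := fun g s => ψ s g
          map_zero' := by ext; simp
          map_add' := fun a b => by ext; simp }
      map_add' := fun ψ ψ' => by
        ext g
        exact congrArg Subtype.val (map_add e (fun s => ψ s g) (fun s => ψ' s g))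
      map_smul' := fun c ψ => by
        ext g
        exact congrArg Subtype.val (map_smul e c (fun s => ψ s g)) }
  have hφ : ∀ ψ, φ ψ = 0 → ψ = 0 := fun ψ h => by
    ext s g
    have h1 : e (fun s => ψ s (Additive.ofMul g)) = 0 := DFunLike.congr_fun h (Additive.ofMul g)
    exact congrFun ((map_eq_zero_iff e e.injective).1 h1) s
  let X : (Fin l → Additive G →+ k) × (Fin P.n → B) →ₗ[k] (Fin P.n → A) :=
    { toFun := fun v i => (φ v.1 (Additive.ofMul (P.gen i)) : A) + v.2 i
      map_add' := fun v w => by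
        ext i
        simp only [Prod.fst_add, Prod.snd_add, map_add, AddMonoidHom.add_apply, Pi.add_apply,
          Submodule.coe_add]
        abel
      map_smul' := fun c v => by
        ext i
        simp }
  have hX : ∀ v, X v = 0 → v = 0 := by
    intro v hv
    have h : ∀ i, (φ v.1 (Additive.ofMul (P.gen i)) : A) = 0 ∧ (v.2 i : A) = 0 := by
      intro i
      have h1 : (φ v.1 (Additive.ofMul (P.gen i)) : A) + v.2 i = 0 := congrFun hv i
      have h2 : (v.2 i : A) = 0 := by
        refine Submodule.disjoint_def.1 hdisj _ (v.2 i).2 ?_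
        rw [eq_neg_of_add_eq_zero_right h1]
        exact V.neg_mem (Subtype.prop _)
      exact ⟨by rwa [h2, add_zero] at h1, h2⟩
    refine Prod.ext (hφ _ (P.hom_eq_zero fun i => Subtype.ext (h i).1)) ?_
    ext i
    exact (h i).2
  have hB : ∀ v j, fox ρ P.gen (P.rel j) (X v) ∈ B := by
    intro v j
    have h1 := fox_sub_mem (ρ := ρ) (γ := P.gen) (x := X v) (le_sup_left : B ≤ B ⊔ V) hact
      (V.subtype.toAddMonoidHom.comp (φ v.1))
      (fun g => Submodule.mem_sup_right (Subtype.prop (φ v.1 g)))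
      (fun i => by simp [X]) (P.rel j)
    rw [P.lift_gen_rel j, ofMul_one, map_zero, sub_zero] at h1
    exact h1
  let f : (Fin l → Additive G →+ k) × (Fin P.n → B) →ₗ[k] (Fin P.m → B) := LinearMap.pi fun j =>
    ((fox ρ P.gen (P.rel j)) ∘ₗ X).codRestrict B fun v => hB v j
  have hf : ∀ v ∈ LinearMap.ker f, ∀ j, fox ρ P.gen (P.rel j) (X v) = 0 := fun v hv j =>
    congrArg Subtype.val (congrFun (LinearMap.mem_ker.1 hv) j)
  -- the kernel of `f` consists of the tuples that extend to crossed homomorphisms on `G`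
  let D : LinearMap.ker f →ₗ[k] crossedHoms ρ :=
    ((P.crossedHomOfGen ρ ∘ₗ X) ∘ₗ (LinearMap.ker f).subtype).codRestrict _
      fun v => crossedHomOfGen_mem (hf v v.2)
  have hD : Function.Injective D := by
    rw [injective_iff_map_eq_zero]
    intro v hv
    refine Subtype.ext (hX _ (funext fun i => ?_))
    have h1 := crossedHomOfGen_apply (hf v v.2) (FreeGroup.of i)
    rw [fox_of] at h1
    exact h1.symm.trans (congrFun (congrArg Subtype.val hv) _)
  have h1 := LinearMap.finrank_le_finrank_of_injective hD
  have h2 := LinearMap.finrank_range_add_finrank_ker f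
  have h3 := Submodule.finrank_le (LinearMap.range f)
  have h4 : Module.finrank k ((Fin l → Additive G →+ k) × (Fin P.n → B))
      = l * Module.finrank k (Additive G →+ k) + P.n * Module.finrank k B := by
    simp [Module.finrank_prod, Module.finrank_pi_fintype]
  have h5 : Module.finrank k (Fin P.m → B) = P.m * Module.finrank k B := by
    simp [Module.finrank_pi_fintype]
  change l * _ + _ ≤ _
  omega

/-- The dimension of `Hom(G, k)` is at least the deficiency. -/
theorem FinitePresentation.deficiency_le (k : Type*) [Field k] (P : FinitePresentation G) :
    P.deficiency ≤ Module.finrank k (Additive G →+ k) := by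
  -- with `B` everything, the estimate compares `n` with `dim Hom(G, k) + m`
  have h := P.finrank_crossedHoms_ge (ρ := Representation.trivial k G k) (B := ⊤) (V := ⊥)
    disjoint_bot_right (by simp)
  rw [(crossedHomsTrivialEquiv k G).finrank_eq] at h
  simp only [finrank_bot, finrank_top, Module.finrank_self] at h
  rw [FinitePresentation.deficiency]
  omega

end Presentation

/-! ### Crossed homomorphisms with coinduced coefficients -/

section Shapiro

variable {k G H : Type*} [Field k] [Group G] [Group H]

/-- The coinduced representation of `G` on `k[H]* = (H → k)` along `π : G → H`:
`(g f)(x) = f(x π(g))`. -/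
def coindRep (k : Type*) [Field k] (π : G →* H) :
    Representation k G (Module.Dual k (MonoidAlgebra k H)) where
  toFun g := (LinearMap.mulRight k (MonoidAlgebra.of k H (π g))).dualMap
  map_one' := by ext; simp
  map_mul' g g' := by ext; simp [mul_assoc]

lemma coindRep_apply (π : G →* H) (g : G) (f : Module.Dual k (MonoidAlgebra k H))
    (x : MonoidAlgebra k H) : coindRep k π g f x = f (x * MonoidAlgebra.of k H (π g)) := rfl

/-- The inequality half of Shapiro's lemma: restricting crossed homomorphisms `G → k[H]*` to the
kernel of `π` and evaluating at `1 ∈ k[H]` gives homomorphisms to `k`; what is lost is determined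
by the values at representatives of the `|H| - 1` nontrivial cosets. -/
theorem finrank_crossedHoms_coindRep_add_one_le [Finite H] {π : G →* H}
    (hπ : Function.Surjective π) {N : Subgroup G} (hN : π.ker = N) [Group.FG N] :
    Module.finrank k (crossedHoms (coindRep k π)) + 1 ≤
      Module.finrank k (Additive N →+ k) + Nat.card H := by
  classical
  have := Fintype.ofFinite H
  let s := Function.surjInv hπ
  have hs : ∀ h, π (s h) = h := Function.surjInv_eq hπ
  have hNπ : ∀ n : N, π n = 1 := fun n => MonoidHom.mem_ker.1 (hN ▸ n.2)
  have key : ∀ {D : G → Module.Dual k (MonoidAlgebra k H)}, D ∈ crossedHoms (coindRep k π) →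
      ∀ g h, D (g * h) 1 = D g 1 + D h (MonoidAlgebra.of k H (π g)) := fun {D} hD g h => by
    rw [hD g h, LinearMap.add_apply, coindRep_apply, one_mul]
  have keyN : ∀ {D : G → Module.Dual k (MonoidAlgebra k H)}, D ∈ crossedHoms (coindRep k π) →
      ∀ (n : N) h, D (n * h) 1 = D n 1 + D h 1 := fun {D} hD n h => by
    rw [key hD, hNπ, map_one (MonoidAlgebra.of k H)]
  let F : crossedHoms (coindRep k π) →ₗ[k] (Additive N →+ k) × ({h : H // h ≠ 1} → k) :=
    { toFun := fun D =>
        ({ toFun := fun n => D.1 (n.toMul : N) 1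
           map_zero' := by
            change D.1 1 1 = 0
            rw [crossedHoms.map_one D.2, LinearMap.zero_apply]
           map_add' := fun a b => keyN D.2 a.toMul b.toMul }, fun h => D.1 (s h) 1)
      map_add' := fun _ _ => rfl
      map_smul' := fun _ _ => rfl }
  have hF : Function.Injective F := by
    rw [injective_iff_map_eq_zero]
    rintro ⟨D, hD⟩ h
    have hn : ∀ n : N, D n 1 = 0 := fun n =>
      DFunLike.congr_fun (congrArg Prod.fst h) (Additive.ofMul n)
    have hsv : ∀ a : H, a ≠ 1 → D (s a) 1 = 0 := fun a ha =>
      congrFun (congrArg Prod.snd h) ⟨a, ha⟩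
    have h1 : ∀ g, D g 1 = 0 := by
      intro g
      by_cases hg : π g = 1
      · exact hn ⟨g, hN ▸ MonoidHom.mem_ker.2 hg⟩
      -- write `g = n s(π g)` with `n ∈ N`
      · have hmem : g * (s (π g))⁻¹ ∈ N := by
          rw [← hN, MonoidHom.mem_ker, map_mul, map_inv, hs, mul_inv_cancel]
        have h2 := keyN hD ⟨_, hmem⟩ (s (π g))
        rwa [inv_mul_cancel_right, hn, hsv _ hg, add_zero] at h2
    refine Subtype.ext (funext fun g => MonoidAlgebra.lhom_ext' fun a => LinearMap.ext_ring ?_)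
    have h2 := key hD (s a) g
    rw [h1, h1, zero_add, hs] at h2
    exact h2.symm
  have h1 := LinearMap.finrank_le_finrank_of_injective hF
  rw [Module.finrank_prod, Module.finrank_fintype_fun_eq_card, Fintype.card_subtype_compl,
    Fintype.card_subtype_eq] at h1
  have h2 : 0 < Fintype.card H := Fintype.card_pos
  rw [Nat.card_eq_fintype_card]
  omega

end Shapiro

/-! ### The filtration dual to the powers of the augmentation ideal -/

section Filtration

lemma augmentationPow_succ_le (p : ℕ) (H : Type*) [Group H] (j : ℕ) :
    augmentationPow p H (j + 1) ≤ augmentationPow p H j :=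
  fun _ hx => Ideal.pow_le_pow_right j.le_succ hx

variable {p : ℕ} {H : Type*} [Group H]

lemma mul_of_sub_self_mem {j : ℕ} {x : MonoidAlgebra (ZMod p) H} (hx : x ∈ augmentationPow p H j)
    (h : H) : x * MonoidAlgebra.of (ZMod p) H h - x ∈ augmentationPow p H (j + 1) := by
  have h1 : MonoidAlgebra.of (ZMod p) H h - 1 ∈ augmentationIdeal p H := by
    simp [augmentationIdeal, RingHom.mem_ker, augmentation]
  have h2 : x * (MonoidAlgebra.of (ZMod p) H h - 1) ∈ augmentationIdeal p H ^ (j + 1) := by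
    rw [Submodule.pow_succ]
    exact Ideal.mul_mem_mul hx h1
  rwa [mul_sub, mul_one] at h2

/-- The annihilator of `Δʲ` in `𝔽_p[H]*`; these subspaces form the increasing filtration dual to
the powers of `Δ`. -/
def annPow (p : ℕ) (H : Type*) [Group H] (j : ℕ) :
    Submodule (ZMod p) (Module.Dual (ZMod p) (MonoidAlgebra (ZMod p) H)) :=
  (augmentationPow p H j).dualAnnihilator

lemma annPow_le_succ (j : ℕ) : annPow p H j ≤ annPow p H (j + 1) :=
  Submodule.dualAnnihilator_anti (augmentationPow_succ_le p H j)

variable [Fact p.Prime]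

lemma coindRep_sub_mem {G : Type*} [Group G] (π : G →* H) (j : ℕ) (g : G)
    {f : Module.Dual (ZMod p) (MonoidAlgebra (ZMod p) H)} (hf : f ∈ annPow p H (j + 1)) :
    coindRep (ZMod p) π g f - f ∈ annPow p H j := by
  rw [annPow, Submodule.mem_dualAnnihilator] at hf ⊢
  intro x hx
  rw [LinearMap.sub_apply, coindRep_apply, ← map_sub]
  exact hf _ (mul_of_sub_self_mem hx _)

variable [Finite H]

lemma finrank_annPow_succ (j : ℕ) :
    Module.finrank (ZMod p) (annPow p H (j + 1)) =
      Module.finrank (ZMod p) (annPow p H j) + lam p H j := by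
  have : Module.Finite (ZMod p) (MonoidAlgebra (ZMod p) H) := inferInstance
  have h1 := Subspace.finrank_add_finrank_dualAnnihilator_eq (augmentationPow p H j)
  have h2 := Subspace.finrank_add_finrank_dualAnnihilator_eq (augmentationPow p H (j + 1))
  have h3 := Submodule.finrank_quotient_add_finrank
    ((augmentationPow p H (j + 1)).submoduleOf (augmentationPow p H j))
  rw [(Submodule.submoduleOfEquivOfLe (augmentationPow_succ_le p H j)).finrank_eq] at h3
  rw [lam, annPow, annPow]
  omega

lemma finrank_annPow (j : ℕ) :
    Module.finrank (ZMod p) (annPow p H j) = ∑ i ∈ Finset.range j, lam p H i := by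
  induction j with
  | zero =>
    have h : annPow p H 0 = ⊥ := by
      rw [annPow, augmentationPow, Submodule.pow_zero, Ideal.one_eq_top,
        Submodule.restrictScalars_top, Submodule.dualAnnihilator_top]
    rw [h, finrank_bot, Finset.sum_range_zero]
  | succ j ih => rw [finrank_annPow_succ, ih, Finset.sum_range_succ]

end Filtration

end HomologyEstimate

end

/-! ### The homology estimate -/

open HomologyEstimate in
theorem theorem6p1 {G : Type*} [Group G] (d : ℤ)
    (P : HomologyEstimate.FinitePresentation G) (hd : d ≤ P.deficiency)
    (p : ℕ) [Fact p.Prime] :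
    Module.Finite (HomologyEstimate.Fp p) (HomologyEstimate.H₁ p G) ∧
    d ≤ (HomologyEstimate.b₁ p G : ℤ) ∧
    ∀ (N : Subgroup G) [N.Normal] [N.FiniteIndex] {H : Type*} [Group H] (_ : G ⧸ N ≃* H),
      Module.Finite (HomologyEstimate.Fp p) (HomologyEstimate.H₁ p N) ∧
      ∀ k : ℕ,
        (HomologyEstimate.b₁ p N : ℤ) ≥
          1 + (HomologyEstimate.b₁ p G : ℤ) * (HomologyEstimate.lam p H k : ℤ)
            + d * ∑ j ∈ Finset.range k, (HomologyEstimate.lam p H j : ℤ) - (Nat.card H : ℤ) := by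
  have := P.fg
  obtain ⟨hG, hbG⟩ := finite_H₁ (p := p) (G := G)
  refine ⟨hG, ?_, ?_⟩
  · rw [hbG]
    exact hd.trans (P.deficiency_le (ZMod p))
  intro N _ _ H _ e
  have : Group.FG N := Subgroup.fg_of_index_ne_zero N
  obtain ⟨hfN, hbN⟩ := finite_H₁ (p := p) (G := N)
  refine ⟨hfN, fun k => ?_⟩
  have : Finite H := Finite.of_equiv _ e.toEquiv
  let π : G →* H := e.toMonoidHom.comp (QuotientGroup.mk' N)
  have hπ : Function.Surjective π := e.surjective.comp (QuotientGroup.mk'_surjective N)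
  have hker : π.ker = N := by
    ext g
    simp [π]
  have hshapiro := finrank_crossedHoms_coindRep_add_one_le (k := ZMod p) hπ hker
  -- split the step `annPow k ≤ annPow (k + 1)` of the filtration
  obtain ⟨W, hW⟩ := Submodule.exists_isCompl (annPow p H k)
  let V := W ⊓ annPow p H (k + 1)
  have hdisj : Disjoint (annPow p H k) V := hW.disjoint.mono_right inf_le_left
  have hsup : annPow p H k ⊔ V = annPow p H (k + 1) := by
    rw [← sup_inf_assoc_of_le W (annPow_le_succ k), hW.sup_eq_top, top_inf_eq]
  have hV := Submodule.finrank_sup_add_finrank_inf_eq (annPow p H k) V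
  rw [hsup, hdisj.eq_bot, finrank_bot, finrank_annPow_succ] at hV
  have heuler := P.finrank_crossedHoms_ge (ρ := coindRep (ZMod p) π) hdisj
    (fun g a ha => coindRep_sub_mem π k g (hsup ▸ ha))
  have hVdim : Module.finrank (ZMod p) V = lam p H k := by omega
  rw [hVdim, finrank_annPow, ← hbG] at heuler
  rw [← hbN] at hshapiro
  rw [FinitePresentation.deficiency] at hd
  have hdS := mul_le_mul_of_nonneg_right hd
    (Nat.cast_nonneg (α := ℤ) (∑ j ∈ Finset.range k, lam p H j))
  zify at heuler hshapiro
  push_cast at hdS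
  linarith
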